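/- \textbf{Setting.} Let $X$ be a Polish space, let $Y,\mathcal H_1,\mathcal H_2$ be real separable Hilbert spaces, where $\mathcal H_2$ is a vector-valued reproducing kernel Hilbert space of functions $X\to Y$; for $x\in X$ let $K_x:Y\to\mathcal H_2$ be the adjoint of the evaluation $f\mapsto f(x)$. Let $\rho$ be a Borel probability measure on $X\times Y$ with marginal $\rho_X$ on $X$ and conditional distributions $\rho(\cdot\mid x)$ on $Y$. Let $A:\mathcal D(A)\subset\mathcal H_1\to\mathcal H_2$ be a (non-linear) operator, and let $f_\rho,\bar f\in\mathcal H_1$. Assume: (1) (True solution) $f_\rho\in\operatorname{int}\mathcal D(A)$, and for $\rho_X$-almost every $x$ the conditional expectation $\int_Y y\,d\rho(y\mid x)$ exists and equals $A(f_\rho)(x)$. (2) (Bernstein-type noise condition) There are constants $M,\Sigma>0$ such that for $\rho_X$-almost every $x$ $$\int_Y\Big(e^{\|y-A(f_\rho)(x)\|_Y/M}-\frac{\|y-A(f_\rho)(x)\|_Y}{M}-1\Big)\,d\rho(y\mid x)\le\frac{\Sigma^2}{2M^2}.$$ (3) (Kernel) Every $K_x$ is a Hilbert--Schmidt operator, $\sup_{x\in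 X}\|K_x\|_{HS}^2<\infty$, and for all $v,w\in Y$ the function $(x,t)\mapsto\langle K_tv,K_xw\rangle_{\mathcal H_2}$ is measurable on $X\times X$. (4) (Operator) $\mathcal D(A)$ is weakly closed with non-empty interior, $A:\mathcal D(A)\to\mathcal H_2$ is Lipschitz continuous, and $A$, regarded as a map from $\mathcal D(A)$ into $L^2(X,\rho_X;Y)$, is one-to-one and weakly sequentially closed. The latter means: if $f_n\in\mathcal D(A)$ converges weakly to $f$ in $\mathcal H_1$ and $A(f_n)$ converges weakly to $g$ in $L^2(X,\rho_X;Y)$, then $f\in\mathcal D(A)$ and $A(f)=g$ in $L^2(X,\rho_X;Y)$. Let $(x_i,y_i)_{i\ge1}$ be an i.i.d. sequence with law $\rho$, write $\mathbf z=\{(x_i,y_i)\}_{i=1}^m$, and let the regularization parameters $\lambda=\lambda(m)>0$ satisfy $$\lambda(m)\to0,\qquad \frac{\log m}{\lambda(m)\sqrt m}\to0\qquad(m\to\infty).$$ \textbf{Theorem.} Almost surely, the following holds for every choice, for all $m\ge1$, of a (not necessarily unique) minimizer $$f_{\mathbf z,\lambda}\in\operatorname*{argmin}_{f\in\mathcal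 D(A)}\Big\{\frac1m\sum_{i=1}^m\|A(f)(x_i)-y_i\|_Y^2+\lambda(m)\,\|f-\bar f\|_{\mathcal H_1}^2\Big\}:$$ $$\|f_{\mathbf z,\lambda}-f_\rho\|_{\mathcal H_1}\to0\qquad\text{as } m\to\infty .$$ -/

import Mathlib

open MeasureTheory ProbabilityTheory Filter Topology
open scoped ENNReal NNReal

/-- The squared Hilbert-Schmidt norm of a bounded operator between real Hilbert spaces, i.e. the
trace of `T* T`: the supremum over all finite orthonormal families `s` of `∑ e ∈ s, ‖T e‖²`.
`hsNormSq_eq_tsum` identifies it with `∑ i, ‖T (b i)‖²` for an arbitrary orthonormal basis `b`. -/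
noncomputable def hsNormSq {E F : Type*} [NormedAddCommGroup E] [InnerProductSpace ℝ E]
    [NormedAddCommGroup F] [InnerProductSpace ℝ F] (T : E →L[ℝ] F) : ℝ≥0∞ :=
  ⨆ (s : Finset E) (_ : Orthonormal ℝ (fun e : s => (e : E))), ∑ e ∈ s, ‖T e‖ₑ ^ 2

theorem tsum_enorm_inner_sq {E ι : Type*} [NormedAddCommGroup E] [InnerProductSpace ℝ E]
    (b : HilbertBasis ι ℝ E) (x : E) :
    ∑' i, ‖inner ℝ (b i) x‖ₑ ^ 2 = ‖x‖ₑ ^ 2 := by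
  have h := b.hasSum_inner_mul_inner x x
  rw [real_inner_self_eq_norm_sq] at h
  have h' : HasSum (fun i => ‖inner ℝ (b i) x‖ ^ 2) (‖x‖ ^ 2) := by
    have he : (fun i => ‖inner ℝ (b i) x‖ ^ 2) = fun i => inner ℝ x (b i) * inner ℝ (b i) x := by
      funext i
      rw [real_inner_comm, Real.norm_eq_abs, sq_abs, sq]
    rwa [he]
  have h2 := ENNReal.ofReal_tsum_of_nonneg (fun i => sq_nonneg ‖inner ℝ (b i) x‖) h'.summable
  rw [h'.tsum_eq] at h2
  simp only [ENNReal.ofReal_pow (norm_nonneg _), ofReal_norm] at h2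
  exact h2.symm

theorem sum_enorm_inner_sq_le {E : Type*} [NormedAddCommGroup E] [InnerProductSpace ℝ E]
    {s : Finset E} (hs : Orthonormal ℝ (fun e : s => (e : E))) (x : E) :
    ∑ e ∈ s, ‖inner ℝ e x‖ₑ ^ 2 ≤ ‖x‖ₑ ^ 2 := by
  have h := hs.sum_inner_products_le x (s := Finset.univ)
  rw [Finset.sum_coe_sort s (fun e => ‖inner ℝ e x‖ ^ 2)] at h
  have h2 := ENNReal.ofReal_le_ofReal h
  rw [ENNReal.ofReal_sum_of_nonneg (fun i _ => sq_nonneg _)] at h2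
  simp only [ENNReal.ofReal_pow (norm_nonneg _), ofReal_norm] at h2
  exact h2

theorem hsNormSq_eq_tsum {E F ι : Type*} [NormedAddCommGroup E] [InnerProductSpace ℝ E]
    [CompleteSpace E] [NormedAddCommGroup F] [InnerProductSpace ℝ F] [CompleteSpace F]
    (b : HilbertBasis ι ℝ E) (T : E →L[ℝ] F) :
    hsNormSq T = ∑' i, ‖T (b i)‖ₑ ^ 2 := by
  classical
  apply le_antisymm
  · obtain ⟨w, c, -⟩ := exists_hilbertBasis ℝ F
    have key : ∀ e : E, ‖T e‖ₑ ^ 2 = ∑' j, ‖inner ℝ e (T.adjoint (c j))‖ₑ ^ 2 := by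
      intro e
      rw [← tsum_enorm_inner_sq c (T e)]
      simp_rw [ContinuousLinearMap.adjoint_inner_right, real_inner_comm]
    refine iSup₂_le fun s hs => ?_
    calc ∑ e ∈ s, ‖T e‖ₑ ^ 2
        = ∑' j, ∑ e ∈ s, ‖inner ℝ e (T.adjoint (c j))‖ₑ ^ 2 := by
          rw [Summable.tsum_finsetSum fun _ _ => ENNReal.summable]
          exact Finset.sum_congr rfl fun e _ => key e
      _ ≤ ∑' j, ‖T.adjoint (c j)‖ₑ ^ 2 :=
          ENNReal.tsum_le_tsum fun j => sum_enorm_inner_sq_le hs _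
      _ = ∑' j, ∑' i, ‖inner ℝ (b i) (T.adjoint (c j))‖ₑ ^ 2 := by
          simp_rw [tsum_enorm_inner_sq b]
      _ = ∑' i, ‖T (b i)‖ₑ ^ 2 := by
          rw [ENNReal.tsum_comm]
          simp_rw [← key]
  · rw [ENNReal.tsum_eq_iSup_sum]
    refine iSup_le fun t => ?_
    have hinj : Function.Injective (b : ι → E) := b.orthonormal.linearIndependent.injective
    have ho : Orthonormal ℝ (fun e : (t.image b) => (e : E)) := by
      have h1 := b.orthonormal.toSubtypeRange
      have hsub : ∀ e : (t.image b), (e : E) ∈ Set.range b := fun e => by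
        obtain ⟨i, -, hi⟩ := Finset.mem_image.1 e.2
        exact ⟨i, hi⟩
      exact h1.comp (fun e : (t.image b) => (⟨e, hsub e⟩ : Set.range b))
        (fun x y hxy => Subtype.ext
          (congrArg (fun q : Set.range b => (q : E)) hxy))
    refine le_trans (le_of_eq ?_) (le_iSup₂_of_le (t.image b) ho le_rfl)
    rw [Finset.sum_image fun x _ y _ h => hinj h]

/-- The vector-valued reproducing kernel Hilbert space `H₂` of functions `X → Y`, with
`K_x = RKHS.kerFun H₂ x : Y → H₂`, has uniformly bounded Hilbert-Schmidt norms
`sup_x ‖K_x‖_HS² < ∞`, and `(x, t) ↦ ⟪K_t v, K_x w⟫` is measurable for all `v, w ∈ Y`. -/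
structure KernelAssumption (X Y H₂ : Type*) [MeasurableSpace X]
    [NormedAddCommGroup Y] [InnerProductSpace ℝ Y] [CompleteSpace Y]
    [NormedAddCommGroup H₂] [InnerProductSpace ℝ H₂] [CompleteSpace H₂] [RKHS ℝ H₂ X Y] :
    Prop where
  hilbertSchmidt : ⨆ x : X, hsNormSq (RKHS.kerFun H₂ x) < ∞
  measurable_kernel : ∀ v w : Y, Measurable fun p : X × X =>
    inner ℝ (RKHS.kerFun H₂ p.2 v) (RKHS.kerFun H₂ p.1 w)

/-- `fρ` is an interior point of the domain `D` of the operator `A`, and for almost every `x` the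
conditional expectation of `y` given `x` exists and equals `A(fρ)(x)`. Here `ρ.fst` is the marginal
distribution on `X` and `ρ.condKernel x` is the conditional distribution of `y` given `x`. -/
structure IsTrueSolution {X Y H₁ H₂ : Type*} [MeasurableSpace X]
    [NormedAddCommGroup Y] [InnerProductSpace ℝ Y] [MeasurableSpace Y] [StandardBorelSpace Y]
    [NormedAddCommGroup H₁] [InnerProductSpace ℝ H₁]
    [NormedAddCommGroup H₂] [InnerProductSpace ℝ H₂] [RKHS ℝ H₂ X Y]
    (ρ : Measure (X × Y)) [IsProbabilityMeasure ρ] (D : Set H₁) (A : H₁ → H₂) (fρ : H₁) :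
    Prop where
  mem_interior : fρ ∈ interior D
  condExp_eq : ∀ᵐ x ∂ρ.fst, Integrable (fun y => y) (ρ.condKernel x) ∧
    ∫ y, y ∂(ρ.condKernel x) = A fρ x

/-- Bernstein-type condition on the noise `y - g x`: there are constants `M, S > 0` such that for
almost every `x` the conditional expectation, given `x`, of
`exp (‖y - g x‖ / M) - ‖y - g x‖ / M - 1` is finite and at most `S² / (2 M²)`. -/
def BernsteinNoise {X Y : Type*} [MeasurableSpace X]
    [NormedAddCommGroup Y] [MeasurableSpace Y] [StandardBorelSpace Y]
    (ρ : Measure (X × Y)) [IsProbabilityMeasure ρ] (g : X → Y) : Prop :=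
  ∃ M S : ℝ, 0 < M ∧ 0 < S ∧ ∀ᵐ x ∂ρ.fst,
    Integrable (fun y => Real.exp (‖y - g x‖ / M) - ‖y - g x‖ / M - 1) (ρ.condKernel x) ∧
    ∫ y, (Real.exp (‖y - g x‖ / M) - ‖y - g x‖ / M - 1) ∂(ρ.condKernel x) ≤ S ^ 2 / (2 * M ^ 2)

/-- Weak convergence of a sequence in a real Hilbert space. -/
def WeaklyTendsto {E : Type*} [NormedAddCommGroup E] [InnerProductSpace ℝ E]
    (u : ℕ → E) (u₀ : E) : Prop :=
  Tendsto (fun n => toWeakSpace ℝ E (u n)) atTop (𝓝 (toWeakSpace ℝ E u₀))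

/-- The operator `A` with domain `D`, regarded as a map into `L²(X, ν; Y)`, is weakly sequentially
closed: if `f n ∈ D` converges weakly to `f₀` in `H₁` and (the class of) `A (f n)` converges weakly
to `g` in `L²(X, ν; Y)`, then `f₀ ∈ D` and `A f₀ = g` in `L²(X, ν; Y)`. -/
def WeaklySeqClosedInL2 {X Y H₁ H₂ : Type*} [MeasurableSpace X]
    [NormedAddCommGroup Y] [InnerProductSpace ℝ Y]
    [NormedAddCommGroup H₁] [InnerProductSpace ℝ H₁]
    [NormedAddCommGroup H₂] [InnerProductSpace ℝ H₂] [RKHS ℝ H₂ X Y]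
    (ν : Measure X) (D : Set H₁) (A : H₁ → H₂) : Prop :=
  ∀ (f : ℕ → H₁) (f₀ : H₁) (u : ℕ → Lp Y 2 ν) (g : Lp Y 2 ν),
    (∀ n, f n ∈ D) → (∀ n, u n =ᵐ[ν] A (f n)) →
    WeaklyTendsto f f₀ → WeaklyTendsto u g → f₀ ∈ D ∧ A f₀ =ᵐ[ν] g

/-- The assumptions on the operator `A : D ⊆ H₁ → H₂`; the values of `A` outside `D` play no role.
The domain is weakly closed with nonempty interior, `A` is Lipschitz continuous on it, and, as a map
into `L²(X, ν; Y)`, `A` is one-to-one and weakly sequentially closed. -/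
structure OperatorAssumption {X Y H₁ H₂ : Type*} [MeasurableSpace X]
    [NormedAddCommGroup Y] [InnerProductSpace ℝ Y]
    [NormedAddCommGroup H₁] [InnerProductSpace ℝ H₁]
    [NormedAddCommGroup H₂] [InnerProductSpace ℝ H₂] [RKHS ℝ H₂ X Y]
    (ν : Measure X) (D : Set H₁) (A : H₁ → H₂) : Prop where
  weakly_closed : IsClosed (toWeakSpace ℝ H₁ '' D)
  nonempty_interior : (interior D).Nonempty
  lipschitz : ∃ L : ℝ≥0, LipschitzOnWith L A D
  injective : ∀ f ∈ D, ∀ g ∈ D, A f =ᵐ[ν] A g → f = g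
  weakly_seq_closed : WeaklySeqClosedInL2 ν D A

/-- The Tikhonov functional `(1/m) ∑ i, ‖A(f)(x i) - y i‖² + lam ‖f - fbar‖²` for the sample
`z i = (x i, y i)`, `i : Fin m`. -/
noncomputable def tikhonov {X Y H₁ H₂ : Type*}
    [NormedAddCommGroup Y] [InnerProductSpace ℝ Y]
    [NormedAddCommGroup H₁] [InnerProductSpace ℝ H₁]
    [NormedAddCommGroup H₂] [InnerProductSpace ℝ H₂] [RKHS ℝ H₂ X Y]
    (A : H₁ → H₂) (fbar : H₁) (lam : ℝ) {m : ℕ} (z : Fin m → X × Y) (f : H₁) : ℝ :=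
  (1 / (m : ℝ)) * ∑ i, ‖A f (z i).1 - (z i).2‖ ^ 2 + lam * ‖f - fbar‖ ^ 2

/-- `f` is a (not necessarily unique) minimizer of the Tikhonov functional over `D`. -/
def IsTikhonovMinimizer {X Y H₁ H₂ : Type*}
    [NormedAddCommGroup Y] [InnerProductSpace ℝ Y]
    [NormedAddCommGroup H₁] [InnerProductSpace ℝ H₁]
    [NormedAddCommGroup H₂] [InnerProductSpace ℝ H₂] [RKHS ℝ H₂ X Y]
    (D : Set H₁) (A : H₁ → H₂) (fbar : H₁) (lam : ℝ) {m : ℕ} (z : Fin m → X × Y) (f : H₁) :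
    Prop :=
  f ∈ D ∧ IsMinOn (tikhonov A fbar lam z) D f

/-! Write `N m = (1/m) ∑ K_{x i} (y i - A fρ (x i))`. Its summands are i.i.d., centred and square
integrable in `H₂`, so Kolmogorov's maximal inequality and Borel–Cantelli on dyadic blocks give
almost surely `‖N m‖ = O(log m / √m) = o(lam m)`. Comparing the Tikhonov functional at the minimizer
and at `fρ`, the noise appears only as `⟪A f - A fρ, N m⟫`, which the Lipschitz bound controls.
Hence `limsup ‖fhat m - fbar‖ ≤ ‖fρ - fbar‖`, and the empirical mean of `‖(A (fhat m) - A fρ) (x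
i)‖²` tends to `0`. To identify weak limit points, let `A (fhat m) - A fρ` tend weakly to `g₀` in
`H₂` along a subsequence. The empirical operators `h ↦ (1/m) ∑ K_{x i} h (x i)` converge pointwise
on a dense set to `J* J`, where `J : H₂ → L²` is the inclusion; with the vanishing empirical error
this forces `J g₀ = 0`. Weak closedness and injectivity of `A` then make `fρ` the only weak limit
point, and the norm bound turns weak into strong convergence. All randomness sits in two almost sure
statements that do not involve the minimizers, so one null set serves every choice of them. The main
carriers are `ae_eventually_norm_sum_le`, `IsTikhonovMinimizer.norm_sub_le` and
`tendsto_of_empirical_tendsto`. -/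

/-! ### Weak sequential convergence in Hilbert spaces. -/

section WeakConvergence

variable {E : Type*} [NormedAddCommGroup E] [InnerProductSpace ℝ E]

theorem WeaklyTendsto.tendsto_clm {u : ℕ → E} {u₀ : E} (h : WeaklyTendsto u u₀) (l : E →L[ℝ] ℝ) :
    Tendsto (fun n => l (u n)) atTop (𝓝 (l u₀)) := by
  have hc : Continuous fun x : WeakSpace ℝ E => topDualPairing ℝ E l ((toWeakSpace ℝ E).symm x) :=
    WeakBilin.eval_continuous (topDualPairing ℝ E).flip l
  exact (hc.tendsto _).comp h

theorem weaklyTendsto_of_forall_clm {u : ℕ → E} {u₀ : E}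
    (h : ∀ l : E →L[ℝ] ℝ, Tendsto (fun n => l (u n)) atTop (𝓝 (l u₀))) : WeaklyTendsto u u₀ := by
  have hind : IsInducing fun (x : WeakSpace ℝ E) (l : E →L[ℝ] ℝ) =>
      (topDualPairing ℝ E).flip x l := ⟨rfl⟩
  unfold WeaklyTendsto
  rw [hind.tendsto_nhds_iff, tendsto_pi_nhds]
  exact h

theorem WeaklyTendsto.tendsto_inner {u : ℕ → E} {u₀ : E} (h : WeaklyTendsto u u₀) (v : E) :
    Tendsto (fun n => inner ℝ v (u n)) atTop (𝓝 (inner ℝ v u₀)) :=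
  h.tendsto_clm (innerSL ℝ v)

theorem weaklyTendsto_of_forall_inner [CompleteSpace E] {u : ℕ → E} {u₀ : E}
    (h : ∀ v : E, Tendsto (fun n => inner ℝ v (u n)) atTop (𝓝 (inner ℝ v u₀))) :
    WeaklyTendsto u u₀ := by
  refine weaklyTendsto_of_forall_clm fun l => ?_
  have hl : ∀ x, l x = inner ℝ ((InnerProductSpace.toDual ℝ E).symm l) x := fun x => by simp
  simpa only [hl] using h _

theorem WeaklyTendsto.map_clm {F : Type*} [NormedAddCommGroup F] [InnerProductSpace ℝ F]
    {u : ℕ → E} {u₀ : E} (h : WeaklyTendsto u u₀) (T : E →L[ℝ] F) :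
    WeaklyTendsto (fun n => T (u n)) (T u₀) :=
  weaklyTendsto_of_forall_clm fun l => h.tendsto_clm (l.comp T)

theorem WeaklyTendsto.comp_strictMono {u : ℕ → E} {u₀ : E} (h : WeaklyTendsto u u₀) {φ : ℕ → ℕ}
    (hφ : StrictMono φ) : WeaklyTendsto (fun n => u (φ n)) u₀ :=
  Tendsto.comp (g := fun n => toWeakSpace ℝ E (u n)) h hφ.tendsto_atTop

/-- Sequential Banach–Alaoglu, transported from the weak dual by the Riesz isomorphism. -/
theorem exists_subseq_weaklyTendsto [CompleteSpace E] [TopologicalSpace.SeparableSpace E]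
    {u : ℕ → E} {C : ℝ} (hu : ∀ n, ‖u n‖ ≤ C) :
    ∃ (u₀ : E) (φ : ℕ → ℕ), StrictMono φ ∧ WeaklyTendsto (fun n => u (φ n)) u₀ := by
  let d : E → WeakDual ℝ E := fun x => StrongDual.toWeakDual (InnerProductSpace.toDual ℝ E x)
  have hmem : ∀ n, d (u n) ∈ WeakDual.toStrongDual ⁻¹' Metric.closedBall (0 : StrongDual ℝ E) C := by
    intro n
    simpa [d] using hu n
  obtain ⟨l, -, φ, hφ, hl⟩ := WeakDual.isSeqCompact_closedBall ℝ E 0 C hmem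
  refine ⟨(InnerProductSpace.toDual ℝ E).symm (WeakDual.toStrongDual l), φ, hφ,
    weaklyTendsto_of_forall_inner fun v => ?_⟩
  have h := ((WeakDual.eval_continuous v).tendsto l).comp hl
  have h1 : ∀ n, inner ℝ v (u (φ n)) = d (u (φ n)) v := fun n => by
    rw [real_inner_comm]; rfl
  have h2 : inner ℝ v ((InnerProductSpace.toDual ℝ E).symm (WeakDual.toStrongDual l)) = l v := by
    rw [real_inner_comm, InnerProductSpace.toDual_symm_apply]; rfl
  simp only [h1, h2]
  exact h

/-- Radon–Riesz argument centred at `c`: in the expansion of `‖(u n - c) - (u₀ - c)‖²` the cross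
term converges by weak convergence, so an asymptotic upper bound on `‖u n - c‖²` suffices. -/
theorem WeaklyTendsto.tendsto_norm_sub {u : ℕ → E} {u₀ c : E} (h : WeaklyTendsto u u₀)
    {r : ℕ → ℝ} (hr : ∀ᶠ n in atTop, ‖u n - c‖ ^ 2 ≤ r n)
    (hr' : Tendsto r atTop (𝓝 (‖u₀ - c‖ ^ 2))) :
    Tendsto (fun n => ‖u n - u₀‖) atTop (𝓝 0) := by
  have h1 : Tendsto (fun n => r n - 2 * (inner ℝ (u₀ - c) (u n) - inner ℝ (u₀ - c) c)
      + ‖u₀ - c‖ ^ 2) atTop (𝓝 0) := by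
    have := (hr'.sub (((h.tendsto_inner (u₀ - c)).sub_const
      (inner ℝ (u₀ - c) c)).const_mul 2)).add_const (‖u₀ - c‖ ^ 2)
    rwa [← inner_sub_right, real_inner_self_eq_norm_sq,
      show ‖u₀ - c‖ ^ 2 - 2 * ‖u₀ - c‖ ^ 2 + ‖u₀ - c‖ ^ 2 = 0 by ring] at this
  have h2 : Tendsto (fun n => ‖u n - u₀‖ ^ 2) atTop (𝓝 0) := by
    refine squeeze_zero' (Eventually.of_forall fun n => sq_nonneg _) ?_ h1
    filter_upwards [hr] with n hn
    have : u n - u₀ = (u n - c) - (u₀ - c) := by abel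
    rw [this, norm_sub_sq_real, real_inner_comm, ← inner_sub_right]
    linarith
  have h3 := h2.sqrt
  simpa [Real.sqrt_sq] using h3

end WeakConvergence

/-! ### Measurability and boundedness of functions in `H₂`. -/

/-- Pairing with a dense sequence is a continuous injection of a Polish space into `ℕ → ℝ`, hence a
measurable embedding (Lusin–Souslin), so measurability can be tested on coordinates. -/
theorem measurable_of_forall_measurable_inner {α E : Type*} [MeasurableSpace α]
    [NormedAddCommGroup E] [InnerProductSpace ℝ E] [CompleteSpace E]
    [TopologicalSpace.SeparableSpace E] [MeasurableSpace E] [BorelSpace E] {f : α → E}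
    (h : ∀ v, Measurable fun a => inner ℝ v (f a)) : Measurable f := by
  let Φ : E → ℕ → ℝ := fun y n => inner ℝ (TopologicalSpace.denseSeq E n) y
  have hΦ : Continuous Φ := continuous_pi fun n => by fun_prop
  have hinj : Function.Injective Φ := by
    intro x y hxy
    refine (TopologicalSpace.denseRange_denseSeq E).eq_of_inner_left ℝ fun n => ?_
    rw [real_inner_comm, real_inner_comm _ y]
    exact congrFun hxy n
  exact (hΦ.measurableEmbedding hinj).measurable_comp_iff.1 (measurable_pi_lambda _ fun n => h _)

section KernelBounds

variable {X Y H₂ : Type*} [MeasurableSpace X]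
    [NormedAddCommGroup Y] [InnerProductSpace ℝ Y] [CompleteSpace Y]
    [NormedAddCommGroup H₂] [InnerProductSpace ℝ H₂] [CompleteSpace H₂] [RKHS ℝ H₂ X Y]

theorem enorm_sq_le_hsNormSq {E F : Type*} [NormedAddCommGroup E] [InnerProductSpace ℝ E]
    [NormedAddCommGroup F] [InnerProductSpace ℝ F] (T : E →L[ℝ] F) {e : E} (he : ‖e‖ = 1) :
    ‖T e‖ₑ ^ 2 ≤ hsNormSq T := by
  refine le_trans (le_of_eq ?_) (le_iSup₂_of_le {e} ?_ le_rfl)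
  · simp
  · refine ⟨fun i => ?_, fun i j hij => (hij (Subsingleton.elim i j)).elim⟩
    have : (i : E) = e := Finset.mem_singleton.1 i.2
    simpa only [this] using he

/-- The Hilbert–Schmidt bound enters the argument only through this operator norm bound. -/
theorem KernelAssumption.exists_norm_kerFun_le (hker : KernelAssumption X Y H₂) :
    ∃ κ : ℝ, 0 ≤ κ ∧ ∀ x, ‖RKHS.kerFun H₂ x‖ ≤ κ := by
  set B := ⨆ x : X, hsNormSq (RKHS.kerFun H₂ x) with hB
  refine ⟨√B.toReal, Real.sqrt_nonneg _, fun x => ?_⟩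
  refine ContinuousLinearMap.opNorm_le_of_unit_norm (Real.sqrt_nonneg _) fun e he => ?_
  have h1 : ‖RKHS.kerFun H₂ x e‖ₑ ^ 2 ≤ B :=
    (enorm_sq_le_hsNormSq _ he).trans (le_iSup (fun x => hsNormSq (RKHS.kerFun H₂ x)) x)
  refine Real.le_sqrt_of_sq_le ?_
  have h2 := ENNReal.toReal_mono hker.hilbertSchmidt.ne h1
  simpa using h2

omit [MeasurableSpace X] in
theorem RKHS.norm_apply_le_of_norm_kerFun_le {κ : ℝ} (hκ : ∀ x, ‖RKHS.kerFun H₂ x‖ ≤ κ)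
    (h : H₂) (x : X) : ‖h x‖ ≤ κ * ‖h‖ := by
  rw [← RKHS.adjoint_kerFun]
  refine (ContinuousLinearMap.le_opNorm _ _).trans ?_
  rw [LinearIsometryEquiv.norm_map]
  gcongr
  exact hκ x

variable [TopologicalSpace.SeparableSpace Y] [MeasurableSpace Y] [BorelSpace Y]

/-- The `h` with `x ↦ ⟪w, h x⟫` measurable form a subspace, closed because evaluations are
continuous. It contains the kernel sections, whose span is dense. -/
theorem KernelAssumption.measurable_coe (hker : KernelAssumption X Y H₂) (h : H₂) :
    Measurable (h : X → Y) := by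
  refine measurable_of_forall_measurable_inner fun w => ?_
  let S : Submodule ℝ H₂ :=
    { carrier := {h | Measurable fun x => inner ℝ w (h x)}
      zero_mem' := by simp
      add_mem' := fun {a b} ha hb => by
        simp only [Set.mem_ofPred_eq, RKHS.coe_add, Pi.add_apply, inner_add_right] at *
        exact ha.add hb
      smul_mem' := fun c a ha => by
        simp only [Set.mem_ofPred_eq, RKHS.coe_smul, Pi.smul_apply, inner_smul_right] at *
        exact ha.const_mul c }
  have hcl : IsClosed (S : Set H₂) := by
    refine IsSeqClosed.isClosed fun u u₀ hu hlim => ?_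
    refine measurable_of_tendsto_metrizable hu (tendsto_pi_nhds.2 fun x => ?_)
    exact ((continuous_const.inner (RKHS.continuous_eval x)).tendsto u₀).comp hlim
  have hspan : Submodule.span ℝ {RKHS.kerFun H₂ x v | (x : X) (v : Y)} ≤ S := by
    rw [Submodule.span_le]
    rintro _ ⟨t, v, rfl⟩
    change Measurable fun x => inner ℝ w (RKHS.kerFun H₂ t v x)
    have := (hker.measurable_kernel v w).comp (measurable_id.prodMk (measurable_const (a := t)))
    convert this using 1
    funext x
    simp [Function.comp, real_inner_comm]
  have htop : (⊤ : Submodule ℝ H₂) ≤ S := by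
    rw [← RKHS.kerFun_dense H₂]
    exact Submodule.topologicalClosure_minimal _ hspan hcl
  exact htop (Submodule.mem_top : h ∈ ⊤)

theorem KernelAssumption.measurable_kerFun_apply [TopologicalSpace.SeparableSpace H₂]
    [MeasurableSpace H₂] [BorelSpace H₂] (hker : KernelAssumption X Y H₂)
    {α : Type*} [MeasurableSpace α] {p : α → X} (hp : Measurable p) {q : α → Y}
    (hq : Measurable q) : Measurable fun a => RKHS.kerFun H₂ (p a) (q a) := by
  refine measurable_of_forall_measurable_inner fun h => ?_
  simp only [RKHS.inner_kerFun]
  exact ((hker.measurable_coe h).comp hp).inner hq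

theorem KernelAssumption.memLp (hker : KernelAssumption X Y H₂) (ν : Measure X) [IsFiniteMeasure ν]
    (h : H₂) : MemLp (h : X → Y) 2 ν := by
  obtain ⟨κ, -, hκ⟩ := hker.exists_norm_kerFun_le
  exact MemLp.of_bound (hker.measurable_coe h).aestronglyMeasurable (κ * ‖h‖)
    (ae_of_all _ fun x => RKHS.norm_apply_le_of_norm_kerFun_le hκ h x)

theorem KernelAssumption.exists_embedding (hker : KernelAssumption X Y H₂) (ν : Measure X)
    [IsProbabilityMeasure ν] : ∃ J : H₂ →L[ℝ] Lp Y 2 ν, ∀ h : H₂, J h =ᵐ[ν] h := by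
  obtain ⟨κ, hκ0, hκ⟩ := hker.exists_norm_kerFun_le
  let J₀ : H₂ →ₗ[ℝ] Lp Y 2 ν :=
    { toFun := fun h => (hker.memLp ν h).toLp
      map_add' := fun a b => by
        rw [← MemLp.toLp_add]
        exact MemLp.toLp_congr _ _ (by simp [RKHS.coe_add])
      map_smul' := fun c a => by
        rw [RingHom.id_apply, ← MemLp.toLp_const_smul]
        exact MemLp.toLp_congr _ _ (by simp [RKHS.coe_smul]) }
  have hJ : ∀ h, J₀ h =ᵐ[ν] h := fun h => MemLp.coeFn_toLp (hker.memLp ν h)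
  refine ⟨J₀.mkContinuous κ fun h => ?_, hJ⟩
  have := Lp.norm_le_of_ae_bound (f := J₀ h) (C := κ * ‖h‖) (by positivity) (by
    filter_upwards [hJ h] with x hx
    rw [hx]
    exact RKHS.norm_apply_le_of_norm_kerFun_le hκ h x)
  simpa [measureUnivNNReal] using this

end KernelBounds

/-! ### Almost sure growth of sums of independent centred vectors. -/

section RandomSums

variable {Ω E : Type*} [MeasurableSpace Ω] {P : Measure Ω} [IsProbabilityMeasure P]
  [NormedAddCommGroup E] [InnerProductSpace ℝ E] [CompleteSpace E]
  [MeasurableSpace E] [BorelSpace E] {ξ : ℕ → Ω → E}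

/-- The partial sum restricted to the past event `s` is independent of the centred `ξ (n + 1)`, so
the cross term integrates to zero. With `s = univ` this gives the variance bound, with general `s`
the submartingale property. -/
theorem norm_sq_sum_setIntegral_succ (hm : ∀ i, StronglyMeasurable (ξ i))
    (hind : iIndepFun ξ P) (h2 : ∀ i, MemLp (ξ i) 2 P) (h0 : ∀ i, ∫ ω, ξ i ω ∂P = 0) (n : ℕ)
    {s : Set Ω} (hs : MeasurableSet[Filtration.natural ξ hm n] s) :
    ∫ ω in s, ‖∑ i ∈ Finset.range (n + 2), ξ i ω‖ ^ 2 ∂P =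
      ∫ ω in s, ‖∑ i ∈ Finset.range (n + 1), ξ i ω‖ ^ 2 ∂P + ∫ ω in s, ‖ξ (n + 1) ω‖ ^ 2 ∂P := by
  have hs' : MeasurableSet s := (Filtration.natural ξ hm).le n s hs
  set S : Ω → E := fun ω => ∑ i ∈ Finset.range (n + 1), ξ i ω with hS
  have hSm : StronglyMeasurable[Filtration.natural ξ hm n] S := by
    refine Finset.stronglyMeasurable_fun_sum _ fun i hi => ?_
    exact ((Filtration.stronglyAdapted_natural hm) i).mono
      ((Filtration.natural ξ hm).mono (Nat.lt_succ_iff.1 (Finset.mem_range.1 hi)))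
  have hS2 : MemLp S 2 P := memLp_finsetSum _ fun i _ => h2 i
  have hIm : StronglyMeasurable[Filtration.natural ξ hm n] (s.indicator S) := hSm.indicator hs
  have hI2 : MemLp (s.indicator S) 2 P := hS2.indicator hs'
  have hindep : IndepFun (s.indicator S) (ξ (n + 1)) P := by
    have h := (hind.indep_comap_natural_of_lt hm (Nat.lt_succ_self n)).symm
    exact indep_of_indep_of_le_left h hIm.measurable.comap_le
  have hcross : ∫ ω in s, inner ℝ (S ω) (ξ (n + 1) ω) ∂P = 0 := by
    have h := hindep.integral_bilin (hI2.integrable one_le_two) ((h2 (n + 1)).integrable one_le_two)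
      (innerSL ℝ)
    rw [h0, map_zero] at h
    rw [← integral_indicator hs', ← h]
    congr 1
    funext ω
    by_cases hω : ω ∈ s <;> simp [hω, innerSL_apply_apply ℝ]
  have hi1 : Integrable (fun ω => ‖S ω‖ ^ 2) P := hS2.integrable_norm_pow two_ne_zero
  have hi2 : Integrable (fun ω => ‖ξ (n + 1) ω‖ ^ 2) P := (h2 (n + 1)).integrable_norm_pow two_ne_zero
  have hi3 : Integrable (fun ω => inner ℝ (S ω) (ξ (n + 1) ω)) P := by
    refine (hi1.add hi2).mono' (hS2.1.inner (h2 (n + 1)).1) (ae_of_all _ fun ω => ?_)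
    refine (norm_inner_le_norm _ _).trans ?_
    simp only [Pi.add_apply]
    nlinarith [sq_nonneg (‖S ω‖ - ‖ξ (n + 1) ω‖), sq_nonneg ‖S ω‖, sq_nonneg ‖ξ (n + 1) ω‖]
  have hexp : ∀ ω, ‖∑ i ∈ Finset.range (n + 2), ξ i ω‖ ^ 2 =
      (‖S ω‖ ^ 2 + 2 * inner ℝ (S ω) (ξ (n + 1) ω)) + ‖ξ (n + 1) ω‖ ^ 2 := fun ω => by
    rw [Finset.sum_range_succ, norm_add_sq_real]
  simp only [hexp]
  have hi4 : Integrable (fun ω => ‖S ω‖ ^ 2 + 2 * inner ℝ (S ω) (ξ (n + 1) ω)) P :=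
    hi1.add (hi3.const_mul 2)
  rw [integral_add hi4.integrableOn hi2.integrableOn,
    integral_add hi1.integrableOn (hi3.integrableOn.const_mul 2), integral_const_mul, hcross]
  simp [hS]

theorem integral_norm_sq_sum_le (hm : ∀ i, StronglyMeasurable (ξ i))
    (hind : iIndepFun ξ P) (h2 : ∀ i, MemLp (ξ i) 2 P) (h0 : ∀ i, ∫ ω, ξ i ω ∂P = 0)
    {V : ℝ} (hV : ∀ i, ∫ ω, ‖ξ i ω‖ ^ 2 ∂P ≤ V) (n : ℕ) :
    ∫ ω, ‖∑ i ∈ Finset.range (n + 1), ξ i ω‖ ^ 2 ∂P ≤ (n + 1) * V := by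
  induction n with
  | zero => simpa using hV 0
  | succ n ih =>
    have h := norm_sq_sum_setIntegral_succ hm hind h2 h0 n MeasurableSet.univ
    simp only [setIntegral_univ] at h
    rw [h]
    push_cast
    linarith [hV (n + 1)]

theorem submartingale_norm_sq_sum (hm : ∀ i, StronglyMeasurable (ξ i))
    (hind : iIndepFun ξ P) (h2 : ∀ i, MemLp (ξ i) 2 P) (h0 : ∀ i, ∫ ω, ξ i ω ∂P = 0) :
    Submartingale (fun n ω => ‖∑ i ∈ Finset.range (n + 1), ξ i ω‖ ^ 2)
      (Filtration.natural ξ hm) P := by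
  refine submartingale_of_setIntegral_le_succ (fun n => ?_) (fun n => ?_) fun n s hs => ?_
  · refine (StronglyMeasurable.norm ?_).pow 2
    refine Finset.stronglyMeasurable_fun_sum _ fun i hi => ?_
    exact ((Filtration.stronglyAdapted_natural hm) i).mono
      ((Filtration.natural ξ hm).mono (Nat.lt_succ_iff.1 (Finset.mem_range.1 hi)))
  · exact (memLp_finsetSum _ fun i _ => h2 i).integrable_norm_pow two_ne_zero
  · rw [norm_sq_sum_setIntegral_succ hm hind h2 h0 n hs]
    exact le_add_of_nonneg_right (integral_nonneg fun ω => sq_nonneg _)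

/-- Kolmogorov's maximal inequality for sums of independent centred Hilbert space valued
random variables. -/
theorem measure_exists_le_norm_sq_sum (hm : ∀ i, StronglyMeasurable (ξ i))
    (hind : iIndepFun ξ P) (h2 : ∀ i, MemLp (ξ i) 2 P) (h0 : ∀ i, ∫ ω, ξ i ω ∂P = 0)
    {V : ℝ} (hV : ∀ i, ∫ ω, ‖ξ i ω‖ ^ 2 ∂P ≤ V) (n : ℕ) {t : ℝ} (ht : 0 < t) :
    P {ω | ∃ k ≤ n, t ≤ ‖∑ i ∈ Finset.range (k + 1), ξ i ω‖ ^ 2} ≤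
      ENNReal.ofReal ((n + 1) * V / t) := by
  have h := maximal_ineq (submartingale_norm_sq_sum hm hind h2 h0)
    (fun n ω => sq_nonneg _) (ε := t.toNNReal) n
  have hset : {ω | ∃ k ≤ n, t ≤ ‖∑ i ∈ Finset.range (k + 1), ξ i ω‖ ^ 2} =
      {ω | (t.toNNReal : ℝ) ≤ (Finset.range (n + 1)).sup' Finset.nonempty_range_add_one
        fun k => ‖∑ i ∈ Finset.range (k + 1), ξ i ω‖ ^ 2} := by
    ext ω
    simp [Finset.le_sup'_iff, Real.coe_toNNReal t ht.le]
  rw [← hset] at h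
  rw [ENNReal.ofReal_div_of_pos ht, ENNReal.le_div_iff_mul_le (by simp [ht]) (by simp), mul_comm]
  refine h.trans (ENNReal.ofReal_le_ofReal ?_)
  refine (setIntegral_le_integral ?_ (ae_of_all _ fun ω => sq_nonneg _)).trans
    (integral_norm_sq_sum_le hm hind h2 h0 hV n)
  exact (memLp_finsetSum _ fun i _ => h2 i).integrable_norm_pow two_ne_zero

/-- The maximal inequality bounds the exceptional probability of block `k` by `(2 ^ k + 1) V / (2 ^
k (k + 1)²) ≤ 2 V / (k + 1)²`, which is summable; Borel–Cantelli concludes. -/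
theorem ae_eventually_norm_sq_sum_lt (hm : ∀ i, StronglyMeasurable (ξ i))
    (hind : iIndepFun ξ P) (h2 : ∀ i, MemLp (ξ i) 2 P) (h0 : ∀ i, ∫ ω, ξ i ω ∂P = 0)
    {V : ℝ} (hV : ∀ i, ∫ ω, ‖ξ i ω‖ ^ 2 ∂P ≤ V) :
    ∀ᵐ ω ∂P, ∀ᶠ k : ℕ in atTop, ∀ m ≤ 2 ^ k,
      ‖∑ i ∈ Finset.range (m + 1), ξ i ω‖ ^ 2 < 2 ^ k * ((k : ℝ) + 1) ^ 2 := by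
  have hV0 : 0 ≤ V := (integral_nonneg fun ω => sq_nonneg _).trans (hV 0)
  let B : ℕ → Set Ω := fun k =>
    {ω | ∃ m ≤ 2 ^ k, 2 ^ k * ((k : ℝ) + 1) ^ 2 ≤ ‖∑ i ∈ Finset.range (m + 1), ξ i ω‖ ^ 2}
  have hsum : Summable fun k : ℕ => 2 * V * (1 / ((k : ℝ) + 1) ^ 2) := by
    refine Summable.mul_left _ ?_
    have := (summable_nat_add_iff 1).2 (Real.summable_one_div_nat_pow.2 one_lt_two)
    simpa using this
  have hB : ∀ k, P (B k) ≤ ENNReal.ofReal (2 * V * (1 / ((k : ℝ) + 1) ^ 2)) := by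
    intro k
    refine (measure_exists_le_norm_sq_sum hm hind h2 h0 hV (2 ^ k) (by positivity)).trans
      (ENNReal.ofReal_le_ofReal ?_)
    have h1 : (1 : ℝ) ≤ 2 ^ k := one_le_pow₀ one_le_two
    rw [mul_one_div, div_le_div_iff₀ (by positivity) (by positivity)]
    push_cast
    have : ((2 : ℝ) ^ k + 1) * V ≤ (2 * 2 ^ k) * V := by gcongr; linarith
    nlinarith [mul_le_mul_of_nonneg_right this (sq_nonneg ((k : ℝ) + 1))]
  have hfin : ∑' k, P (B k) ≠ ∞ := by
    refine ne_top_of_le_ne_top ?_ (ENNReal.tsum_le_tsum hB)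
    exact hsum.tsum_ofReal_ne_top
  filter_upwards [ae_eventually_notMem hfin] with ω hω
  filter_upwards [hω] with k hk m hmk
  by_contra hcon
  exact hk ⟨m, hmk, not_lt.1 hcon⟩

theorem ae_eventually_norm_sum_le (hm : ∀ i, StronglyMeasurable (ξ i))
    (hind : iIndepFun ξ P) (h2 : ∀ i, MemLp (ξ i) 2 P) (h0 : ∀ i, ∫ ω, ξ i ω ∂P = 0)
    {V : ℝ} (hV : ∀ i, ∫ ω, ‖ξ i ω‖ ^ 2 ∂P ≤ V) :
    ∀ᵐ ω ∂P, ∀ᶠ m : ℕ in atTop,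
      ‖∑ i ∈ Finset.range m, ξ i ω‖ ≤ 12 * (√(m : ℝ) * Real.log m) := by
  filter_upwards [ae_eventually_norm_sq_sum_lt hm hind h2 h0 hV] with ω hω
  have hlog : Tendsto (fun m : ℕ => Nat.log 2 m + 1) atTop atTop :=
    (tendsto_add_atTop_nat 1).comp (tendsto_atTop.2 fun b =>
      (eventually_ge_atTop (2 ^ b)).mono fun m hm => Nat.le_log_of_pow_le one_lt_two hm)
  filter_upwards [hlog.eventually hω, eventually_ge_atTop 2] with m hblock hm2
  have hm0 : m ≠ 0 := by omega
  have hlt : m < 2 ^ (Nat.log 2 m + 1) := Nat.lt_pow_succ_log_self one_lt_two m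
  have hle : 2 ^ Nat.log 2 m ≤ m := Nat.pow_log_le_self 2 hm0
  -- Index `m - 1` of the block bound is the sum of `m` terms.
  have h := hblock (m - 1) (by omega)
  rw [Nat.sub_add_cancel (by omega)] at h
  set k := Nat.log 2 m
  have hle' : (2 : ℝ) ^ k ≤ m := by exact_mod_cast hle
  have hl2 : (1 / 2 : ℝ) < Real.log 2 := by linarith [Real.log_two_gt_d9]
  have hlogm : Real.log 2 ≤ Real.log m :=
    Real.log_le_log (by norm_num) (by exact_mod_cast hm2)
  have hk : (k : ℝ) * Real.log 2 ≤ Real.log m := by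
    rw [← Real.log_pow]
    exact Real.log_le_log (by positivity) hle'
  -- From `log 2 > 1/2`: `k ≤ 2 log m` and `2 ≤ 4 log m`. The squared sum is then at most `72 m (log
  -- m)²`, and `72 ≤ 12²`.
  have hk2 : (k : ℝ) + 2 ≤ 6 * Real.log m := by
    nlinarith [(Nat.cast_nonneg k : (0 : ℝ) ≤ k)]
  have hL : 0 ≤ Real.log m := by linarith
  refine (sq_le_sq₀ (norm_nonneg _) (by positivity)).1 ?_
  rw [mul_pow, mul_pow, Real.sq_sqrt (Nat.cast_nonneg m)]
  have hsq : ((k : ℝ) + 2) ^ 2 ≤ (6 * Real.log m) ^ 2 := by gcongr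
  push_cast at h
  calc ‖∑ i ∈ Finset.range m, ξ i ω‖ ^ 2 ≤ 2 ^ (k + 1) * ((k : ℝ) + 1 + 1) ^ 2 := h.le
    _ = (2 * 2 ^ k) * ((k : ℝ) + 2) ^ 2 := by ring
    _ ≤ (2 * m) * (6 * Real.log m) ^ 2 := by gcongr
    _ ≤ 12 ^ 2 * (m * Real.log m ^ 2) := by nlinarith [mul_nonneg (Nat.cast_nonneg m : (0 : ℝ) ≤ m) (sq_nonneg (Real.log m))]

end RandomSums

/-! ### The noise term and the empirical covariance operator. -/

section Noise

variable {X Y : Type*} [MeasurableSpace X]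
    [NormedAddCommGroup Y] [InnerProductSpace ℝ Y] [CompleteSpace Y]
    [TopologicalSpace.SeparableSpace Y] [MeasurableSpace Y] [BorelSpace Y]

omit [InnerProductSpace ℝ Y] in
-- Since `t² / 2 ≤ exp t - t - 1` for `t ≥ 0`, the conditional second moment is at most `S²`;
-- disintegration passes this to `ρ`.
theorem BernsteinNoise.memLp {ρ : Measure (X × Y)} [IsProbabilityMeasure ρ] {g : X → Y}
    (hg : Measurable g) (h : BernsteinNoise ρ g) :
    MemLp (fun p : X × Y => p.2 - g p.1) 2 ρ := by
  have hmeas : Measurable fun p : X × Y => p.2 - g p.1 :=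
    measurable_snd.sub (hg.comp measurable_fst)
  obtain ⟨M, S, hM, hS, h⟩ := h
  refine (memLp_two_iff_integrable_sq_norm hmeas.aestronglyMeasurable).2
    ⟨(hmeas.norm.pow_const 2).aestronglyMeasurable, ?_⟩
  have hle : ∀ᵐ x ∂ρ.fst, ∫⁻ y, ‖‖y - g x‖ ^ 2‖ₑ ∂(ρ.condKernel x) ≤ ENNReal.ofReal (S ^ 2) := by
    filter_upwards [h] with x hx
    have hpt : ∀ y, ‖y - g x‖ ^ 2 ≤
        2 * M ^ 2 * (Real.exp (‖y - g x‖ / M) - ‖y - g x‖ / M - 1) := fun y => by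
      have h1 := Real.quadratic_le_exp_of_nonneg (div_nonneg (norm_nonneg (y - g x)) hM.le)
      calc ‖y - g x‖ ^ 2 = 2 * M ^ 2 * ((‖y - g x‖ / M) ^ 2 / 2) := by field_simp
        _ ≤ _ := by gcongr; linarith
    calc ∫⁻ y, ‖‖y - g x‖ ^ 2‖ₑ ∂(ρ.condKernel x)
        ≤ ∫⁻ y, ENNReal.ofReal (2 * M ^ 2 * (Real.exp (‖y - g x‖ / M) - ‖y - g x‖ / M - 1))
            ∂(ρ.condKernel x) := by
          refine lintegral_mono fun y => ?_
          rw [Real.enorm_of_nonneg (sq_nonneg _)]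
          exact ENNReal.ofReal_le_ofReal (hpt y)
      _ = ENNReal.ofReal (∫ y, 2 * M ^ 2 *
            (Real.exp (‖y - g x‖ / M) - ‖y - g x‖ / M - 1) ∂(ρ.condKernel x)) :=
          (ofReal_integral_eq_lintegral_ofReal (hx.1.const_mul _)
            (ae_of_all _ fun y => (sq_nonneg _).trans (hpt y))).symm
      _ ≤ ENNReal.ofReal (S ^ 2) := by
          refine ENNReal.ofReal_le_ofReal ?_
          rw [integral_const_mul]
          calc _ ≤ 2 * M ^ 2 * (S ^ 2 / (2 * M ^ 2)) := by gcongr; exact hx.2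
            _ = S ^ 2 := by field_simp
  have hl : ∫⁻ p, ‖‖p.2 - g p.1‖ ^ 2‖ₑ ∂ρ ≤ ENNReal.ofReal (S ^ 2) := by
    have hd := ρ.disintegrate ρ.condKernel
    rw [← hd, Measure.lintegral_compProd (hmeas.norm.pow_const 2).enorm]
    refine (lintegral_mono_ae hle).trans ?_
    simp
  exact hl.trans_lt ENNReal.ofReal_lt_top

variable {H₂ : Type*} [NormedAddCommGroup H₂] [InnerProductSpace ℝ H₂] [CompleteSpace H₂]
  [TopologicalSpace.SeparableSpace H₂] [MeasurableSpace H₂] [BorelSpace H₂] [RKHS ℝ H₂ X Y]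

theorem KernelAssumption.memLp_kerFun_apply (hker : KernelAssumption X Y H₂)
    {α : Type*} [MeasurableSpace α] {μ : Measure α} {p : α → X} (hp : Measurable p) {q : α → Y}
    (hq : Measurable q) (hq2 : MemLp q 2 μ) :
    MemLp (fun a => RKHS.kerFun H₂ (p a) (q a)) 2 μ := by
  obtain ⟨κ, -, hκ⟩ := hker.exists_norm_kerFun_le
  refine hq2.of_le_mul (c := κ) (hker.measurable_kerFun_apply hp hq).aestronglyMeasurable
    (ae_of_all _ fun a => ?_)
  exact ((RKHS.kerFun H₂ (p a)).le_opNorm _).trans (by gcongr; exact hκ _)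

/-- Tested against `h`, the reproducing property gives `⟪h x, y - g x⟫`, whose conditional mean
given `x` vanishes. -/
theorem integral_kerFun_noise_eq_zero (hker : KernelAssumption X Y H₂) {ρ : Measure (X × Y)}
    [IsProbabilityMeasure ρ] {g : X → Y} (hg : Measurable g)
    (h2 : MemLp (fun p : X × Y => p.2 - g p.1) 2 ρ)
    (hcond : ∀ᵐ x ∂ρ.fst, Integrable (fun y => y) (ρ.condKernel x) ∧
      ∫ y, y ∂(ρ.condKernel x) = g x) :
    ∫ p, RKHS.kerFun H₂ p.1 (p.2 - g p.1) ∂ρ = 0 := by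
  have hmeas : Measurable fun p : X × Y => p.2 - g p.1 :=
    measurable_snd.sub (hg.comp measurable_fst)
  have hint := (hker.memLp_kerFun_apply measurable_fst hmeas h2).integrable one_le_two
  refine ext_inner_left ℝ fun h => ?_
  rw [← integral_inner hint, inner_zero_right]
  have hint' : Integrable (fun p : X × Y => inner ℝ (h p.1) (p.2 - g p.1)) ρ := by
    simpa only [RKHS.inner_kerFun] using hint.const_inner (𝕜 := ℝ) h
  simp only [RKHS.inner_kerFun]
  have hd := ρ.disintegrate ρ.condKernel
  rw [← hd] at hint'
  calc ∫ p, inner ℝ (h p.1) (p.2 - g p.1) ∂ρ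
      = ∫ p, inner ℝ (h p.1) (p.2 - g p.1) ∂(ρ.fst ⊗ₘ ρ.condKernel) := by rw [hd]
    _ = ∫ x, ∫ y, inner ℝ (h x) (y - g x) ∂(ρ.condKernel x) ∂ρ.fst :=
        Measure.integral_compProd hint'
    _ = 0 := by
        refine integral_eq_zero_of_ae ?_
        filter_upwards [hcond] with x hx
        have hi : Integrable (fun y => y - g x) (ρ.condKernel x) := hx.1.sub (integrable_const _)
        rw [integral_inner hi, integral_sub hx.1 (integrable_const _), hx.2]
        simp

variable {Ω : Type*} [MeasurableSpace Ω] {P : Measure Ω} [IsProbabilityMeasure P]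
  {ρ : Measure (X × Y)} [IsProbabilityMeasure ρ] {z : ℕ → Ω → X × Y}

theorem ae_eventually_norm_noise_sum_le (hker : KernelAssumption X Y H₂) {g : X → Y}
    (hg : Measurable g) (hnoise : BernsteinNoise ρ g)
    (hcond : ∀ᵐ x ∂ρ.fst, Integrable (fun y => y) (ρ.condKernel x) ∧
      ∫ y, y ∂(ρ.condKernel x) = g x)
    (hz_meas : ∀ i, Measurable (z i)) (hz_indep : iIndepFun z P) (hz_law : ∀ i, P.map (z i) = ρ) :
    ∀ᵐ ω ∂P, ∀ᶠ m : ℕ in atTop,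
      ‖∑ i ∈ Finset.range m, RKHS.kerFun H₂ (z i ω).1 ((z i ω).2 - g (z i ω).1)‖ ≤
        12 * (√(m : ℝ) * Real.log m) := by
  have hmeas : Measurable fun p : X × Y => p.2 - g p.1 :=
    measurable_snd.sub (hg.comp measurable_fst)
  have h2 := hnoise.memLp hg
  have hΦ : Measurable fun p : X × Y => RKHS.kerFun H₂ p.1 (p.2 - g p.1) :=
    hker.measurable_kerFun_apply measurable_fst hmeas
  have hΦ2 := hker.memLp_kerFun_apply measurable_fst hmeas h2
  refine ae_eventually_norm_sum_le
    (ξ := fun i ω => RKHS.kerFun H₂ (z i ω).1 ((z i ω).2 - g (z i ω).1))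
    (V := ∫ p, ‖RKHS.kerFun H₂ p.1 (p.2 - g p.1)‖ ^ 2 ∂ρ)
    (fun i => (hΦ.comp (hz_meas i)).stronglyMeasurable) (hz_indep.comp _ fun _ => hΦ)
    (fun i => ?_) (fun i => ?_) fun i => le_of_eq ?_
  · exact hΦ2.comp_measurePreserving ⟨hz_meas i, hz_law i⟩
  · rw [← integral_kerFun_noise_eq_zero hker hg h2 hcond, ← hz_law i,
      integral_map (hz_meas i).aemeasurable hΦ.aestronglyMeasurable]
  · rw [← hz_law i, integral_map (hz_meas i).aemeasurable
      (hΦ.norm.pow_const 2).aestronglyMeasurable]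

/-- This identifies the limit of the empirical operators as `J* J`. -/
theorem KernelAssumption.inner_integral_kerFun (hker : KernelAssumption X Y H₂)
    {J : H₂ →L[ℝ] Lp Y 2 ρ.fst} (hJ : ∀ h : H₂, J h =ᵐ[ρ.fst] h) (g h : H₂) :
    inner ℝ g (∫ p, RKHS.kerFun H₂ p.1 (h p.1) ∂ρ) = inner ℝ (J g) (J h) := by
  have hm : Measurable fun p : X × Y => h p.1 := (hker.measurable_coe h).comp measurable_fst
  have hL : MemLp (fun p : X × Y => h p.1) 2 ρ :=
    (hker.memLp ρ.fst h).comp_measurePreserving ⟨measurable_fst, rfl⟩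
  have hint := (hker.memLp_kerFun_apply measurable_fst hm hL).integrable one_le_two
  rw [← integral_inner hint, L2.inner_def]
  simp only [RKHS.inner_kerFun]
  have hgh : Measurable fun x => inner ℝ (g x) (h x) :=
    (hker.measurable_coe g).inner (hker.measurable_coe h)
  calc ∫ p, inner ℝ (g p.1) (h p.1) ∂ρ = ∫ x, inner ℝ (g x) (h x) ∂ρ.fst := by
        rw [Measure.fst, integral_map measurable_fst.aemeasurable hgh.aestronglyMeasurable]
    _ = _ := by
        refine integral_congr_ae ?_
        filter_upwards [hJ g, hJ h] with x h1 h2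
        rw [h1, h2]

omit [IsProbabilityMeasure P] in
theorem ae_tendsto_empirical_kerFun (hker : KernelAssumption X Y H₂) (h : H₂)
    (hz_meas : ∀ i, Measurable (z i)) (hz_indep : iIndepFun z P) (hz_law : ∀ i, P.map (z i) = ρ) :
    ∀ᵐ ω ∂P, Tendsto (fun m : ℕ => (m : ℝ)⁻¹ •
      ∑ i ∈ Finset.range m, RKHS.kerFun H₂ (z i ω).1 (h (z i ω).1)) atTop
      (𝓝 (∫ p, RKHS.kerFun H₂ p.1 (h p.1) ∂ρ)) := by
  have hm : Measurable fun p : X × Y => h p.1 := (hker.measurable_coe h).comp measurable_fst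
  have hL : MemLp (fun p : X × Y => h p.1) 2 ρ :=
    (hker.memLp ρ.fst h).comp_measurePreserving ⟨measurable_fst, rfl⟩
  have hΦ : Measurable fun p : X × Y => RKHS.kerFun H₂ p.1 (h p.1) :=
    hker.measurable_kerFun_apply measurable_fst hm
  have hint := (hker.memLp_kerFun_apply measurable_fst hm hL).integrable one_le_two
  have hid : ∀ i, IdentDistrib (z i) (z 0) P P := fun i =>
    ⟨(hz_meas i).aemeasurable, (hz_meas 0).aemeasurable, by rw [hz_law, hz_law]⟩
  have hmp : MeasurePreserving (z 0) P ρ := ⟨hz_meas 0, hz_law 0⟩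
  have hs := strong_law_ae (μ := P)
    (fun i ω => RKHS.kerFun H₂ (z i ω).1 (h (z i ω).1))
    (hmp.integrable_comp_of_integrable hint)
    (fun i j hij => ((hz_indep.comp _ fun _ => hΦ).indepFun hij))
    (fun i => (hid i).comp hΦ)
  have he : ∫ p, RKHS.kerFun H₂ p.1 (h p.1) ∂ρ =
      ∫ ω, RKHS.kerFun H₂ (z 0 ω).1 (h (z 0 ω).1) ∂P := by
    rw [← hz_law 0, integral_map (hz_meas 0).aemeasurable hΦ.aestronglyMeasurable]
  rw [he]
  exact hs

end Noise

/-! ### Deterministic analysis of the minimizers along a fixed sample. -/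

section Deterministic

variable {X Y H₁ H₂ : Type*}
    [NormedAddCommGroup Y] [InnerProductSpace ℝ Y] [CompleteSpace Y]
    [NormedAddCommGroup H₁] [InnerProductSpace ℝ H₁]
    [NormedAddCommGroup H₂] [InnerProductSpace ℝ H₂] [CompleteSpace H₂] [RKHS ℝ H₂ X Y]

theorem inner_empirical_kerFun_sq_le {κ : ℝ} (_hκ0 : 0 ≤ κ) (hκ : ∀ x, ‖RKHS.kerFun H₂ x‖ ≤ κ)
    (g h : H₂) (x : ℕ → X) (m : ℕ) :
    inner ℝ g ((m : ℝ)⁻¹ • ∑ i ∈ Finset.range m, RKHS.kerFun H₂ (x i) (h (x i))) ^ 2 ≤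
      (κ * ‖h‖) ^ 2 * ((m : ℝ)⁻¹ * ∑ i ∈ Finset.range m, ‖g (x i)‖ ^ 2) := by
  rw [inner_smul_right, inner_sum]
  simp only [RKHS.inner_kerFun]
  have h1 : (∑ i ∈ Finset.range m, inner ℝ (g (x i)) (h (x i))) ^ 2 ≤
      (m : ℝ) * ∑ i ∈ Finset.range m, (κ * ‖h‖) ^ 2 * ‖g (x i)‖ ^ 2 := by
    have h2 := sq_sum_le_card_mul_sum_sq (s := Finset.range m)
      (f := fun i => inner ℝ (g (x i)) (h (x i)))
    rw [Finset.card_range] at h2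
    refine h2.trans ?_
    gcongr with i hi
    rw [← mul_pow, ← sq_abs]
    gcongr
    refine (abs_real_inner_le_norm _ _).trans ?_
    rw [mul_comm]
    gcongr
    exact RKHS.norm_apply_le_of_norm_kerFun_le hκ h _
  rw [← Finset.mul_sum] at h1
  rcases Nat.eq_zero_or_pos m with rfl | hm
  · simp
  have hm' : (0 : ℝ) < m := by exact_mod_cast hm
  calc _ = ((m : ℝ)⁻¹) ^ 2 * (∑ i ∈ Finset.range m, inner ℝ (g (x i)) (h (x i))) ^ 2 := mul_pow _ _ 2
    _ ≤ ((m : ℝ)⁻¹) ^ 2 *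
        ((m : ℝ) * ((κ * ‖h‖) ^ 2 * ∑ i ∈ Finset.range m, ‖g (x i)‖ ^ 2)) := by gcongr
    _ = _ := by field_simp

/-- After expanding the residual of `f` around that of `fρ`, the pure noise terms cancel and the
reproducing property collects the cross terms into one inner product in `H₂`. -/
theorem IsTikhonovMinimizer.basic_inequality {D : Set H₁} {A : H₁ → H₂} {fρ fbar f : H₁}
    {lam : ℝ} {m : ℕ} {z : ℕ → X × Y} (hfρ : fρ ∈ D)
    (hf : IsTikhonovMinimizer D A fbar lam (fun i : Fin m => z i) f) :
    (m : ℝ)⁻¹ * ∑ i ∈ Finset.range m, ‖(A f - A fρ) (z i).1‖ ^ 2 + lam * ‖f - fbar‖ ^ 2 ≤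
      2 * inner ℝ (A f - A fρ) ((m : ℝ)⁻¹ •
        ∑ i ∈ Finset.range m, RKHS.kerFun H₂ (z i).1 ((z i).2 - A fρ (z i).1)) +
      lam * ‖fρ - fbar‖ ^ 2 := by
  have h : tikhonov A fbar lam (fun i : Fin m => z i) f ≤
      tikhonov A fbar lam (fun i : Fin m => z i) fρ := hf.2 hfρ
  unfold tikhonov at h
  rw [Fin.sum_univ_eq_sum_range (fun i => ‖A f (z i).1 - (z i).2‖ ^ 2),
    Fin.sum_univ_eq_sum_range (fun i => ‖A fρ (z i).1 - (z i).2‖ ^ 2)] at h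
  have hpt : ∀ i, ‖A f (z i).1 - (z i).2‖ ^ 2 = ‖(A f - A fρ) (z i).1‖ ^ 2 -
      2 * inner ℝ ((A f - A fρ) (z i).1) ((z i).2 - A fρ (z i).1) +
      ‖A fρ (z i).1 - (z i).2‖ ^ 2 := fun i => by
    rw [norm_sub_rev (A fρ (z i).1), ← norm_sub_sq_real]
    congr 2
    simp
  simp only [hpt, Finset.sum_add_distrib, Finset.sum_sub_distrib, ← Finset.mul_sum] at h
  rw [inner_smul_right, inner_sum]
  simp only [RKHS.inner_kerFun, one_div] at h ⊢
  linarith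

/-- With `a = ‖f - fbar‖` and `b = ‖fρ - fbar‖`, the Lipschitz bound and division by `lam` give `a²
- b² ≤ η (a + b)`, hence `a ≤ b + η`. -/
theorem IsTikhonovMinimizer.norm_sub_le {D : Set H₁} {A : H₁ → H₂} {fρ fbar f : H₁} {L : ℝ≥0}
    (hL : LipschitzOnWith L A D) {lam : ℝ} (hlam : 0 < lam) {m : ℕ} {z : ℕ → X × Y} (hfρ : fρ ∈ D)
    (hf : IsTikhonovMinimizer D A fbar lam (fun i : Fin m => z i) f) {η : ℝ}
    (hη : 2 * L * ‖(m : ℝ)⁻¹ •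
      ∑ i ∈ Finset.range m, RKHS.kerFun H₂ (z i).1 ((z i).2 - A fρ (z i).1)‖ ≤ η * lam) :
    ‖f - fbar‖ ≤ ‖fρ - fbar‖ + η ∧
      (m : ℝ)⁻¹ * ∑ i ∈ Finset.range m, ‖(A f - A fρ) (z i).1‖ ^ 2 ≤
        lam * (η * (2 * ‖fρ - fbar‖ + η) + ‖fρ - fbar‖ ^ 2) := by
  have hbas := hf.basic_inequality hfρ
  set N := (m : ℝ)⁻¹ • ∑ i ∈ Finset.range m, RKHS.kerFun H₂ (z i).1 ((z i).2 - A fρ (z i).1)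
  set e := (m : ℝ)⁻¹ * ∑ i ∈ Finset.range m, ‖(A f - A fρ) (z i).1‖ ^ 2 with he
  have he0 : 0 ≤ e := by positivity
  set a := ‖f - fbar‖
  set b := ‖fρ - fbar‖
  have ha0 : 0 ≤ a := norm_nonneg _
  have hb0 : 0 ≤ b := norm_nonneg _
  have hη0 : 0 ≤ η := by
    by_contra hneg
    have := (by positivity : 0 ≤ 2 * L * ‖N‖).trans hη
    nlinarith
  have hd : ‖f - fρ‖ ≤ a + b := by
    have : f - fρ = (f - fbar) - (fρ - fbar) := by abel
    rw [this]
    exact _root_.norm_sub_le _ _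
  have hin : 2 * inner ℝ (A f - A fρ) N ≤ lam * (η * (a + b)) := by
    calc 2 * inner ℝ (A f - A fρ) N ≤ 2 * (‖A f - A fρ‖ * ‖N‖) := by
          gcongr; exact real_inner_le_norm _ _
      _ ≤ 2 * ((L * (a + b)) * ‖N‖) := by
          gcongr
          exact (hL.norm_sub_le hf.1 hfρ).trans (by gcongr)
      _ = (2 * L * ‖N‖) * (a + b) := by ring
      _ ≤ (η * lam) * (a + b) := by gcongr
      _ = _ := by ring
  have hle : lam * a ^ 2 ≤ lam * (η * (a + b) + b ^ 2) := by nlinarith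
  have hle' : a ^ 2 ≤ η * (a + b) + b ^ 2 := le_of_mul_le_mul_left hle hlam
  have hab : a ≤ b + η := by
    by_contra hcon
    push Not at hcon
    nlinarith
  refine ⟨hab, ?_⟩
  have hab' : a + b ≤ 2 * b + η := by linarith
  have : lam * (η * (a + b)) ≤ lam * (η * (2 * b + η)) := by gcongr
  nlinarith [mul_nonneg hlam.le (sq_nonneg a)]

variable [CompleteSpace H₁] [TopologicalSpace.SeparableSpace H₁]
  [TopologicalSpace.SeparableSpace H₂] [MeasurableSpace X]

theorem tendsto_of_empirical_tendsto (hker : KernelAssumption X Y H₂) {ν : Measure X}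
    {D : Set H₁} {A : H₁ → H₂} (hop : OperatorAssumption ν D A) {fρ fbar : H₁} (hfρ : fρ ∈ D)
    {J : H₂ →L[ℝ] Lp Y 2 ν} (hJ : ∀ h : H₂, J h =ᵐ[ν] h)
    {x : ℕ → X} {τ : H₂ → H₂} (hτ : ∀ g h, inner ℝ g (τ h) = inner ℝ (J g) (J h))
    {s : Set H₂} (hs : Dense s)
    (hlln : ∀ h ∈ s, Tendsto (fun m : ℕ => (m : ℝ)⁻¹ •
      ∑ i ∈ Finset.range m, RKHS.kerFun H₂ (x i) (h (x i))) atTop (𝓝 (τ h)))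
    {u : ℕ → H₁} (huD : ∀ n, u n ∈ D) {r : ℕ → ℝ} (hr : ∀ n, ‖u n - fbar‖ ^ 2 ≤ r n)
    (hrlim : Tendsto r atTop (𝓝 (‖fρ - fbar‖ ^ 2)))
    {k : ℕ → ℕ} (hk : Tendsto k atTop atTop)
    (hemp : Tendsto (fun n => ((k n : ℕ) : ℝ)⁻¹ *
      ∑ i ∈ Finset.range (k n), ‖(A (u n) - A fρ) (x i)‖ ^ 2) atTop (𝓝 0)) :
    Tendsto (fun n => ‖u n - fρ‖) atTop (𝓝 0) := by
  obtain ⟨κ, hκ0, hκ⟩ := hker.exists_norm_kerFun_le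
  obtain ⟨L, hL⟩ := hop.lipschitz
  obtain ⟨R, hR⟩ := hrlim.bddAbove_range
  have hub : ∀ n, ‖u n - fbar‖ ≤ √R := fun n =>
    Real.le_sqrt_of_sq_le ((hr n).trans (hR ⟨n, rfl⟩))
  have hub1 : ∀ n, ‖u n‖ ≤ √R + ‖fbar‖ := fun n => by
    calc ‖u n‖ = ‖(u n - fbar) + fbar‖ := by simp
      _ ≤ _ := (norm_add_le _ _).trans (by gcongr; exact hub n)
  set G := L * (√R + ‖fbar‖ + ‖fρ‖) with hG
  have hgb : ∀ n, ‖A (u n) - A fρ‖ ≤ G := fun n => by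
    refine (hL.norm_sub_le (huD n) hfρ).trans ?_
    rw [hG]
    gcongr
    exact (_root_.norm_sub_le _ _).trans (by gcongr; exact hub1 n)
  refine tendsto_of_subseq_tendsto fun ns hns => ?_
  obtain ⟨u₀, φ, hφ, hu₀⟩ := exists_subseq_weaklyTendsto (u := fun n => u (ns n))
    fun n => hub1 (ns n)
  obtain ⟨g₀, ψ, hψ, hg₀⟩ := exists_subseq_weaklyTendsto
    (u := fun n => A (u (ns (φ n))) - A fρ) fun n => hgb (ns (φ n))
  let q : ℕ → ℕ := fun n => ns (φ (ψ n))
  have hq : Tendsto q atTop atTop := hns.comp (hφ.tendsto_atTop.comp hψ.tendsto_atTop)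
  have hu : WeaklyTendsto (fun n => u (q n)) u₀ := hu₀.comp_strictMono hψ
  have hg : WeaklyTendsto (fun n => A (u (q n)) - A fρ) g₀ := hg₀
  -- Against the empirical `T n` the pairing vanishes by Cauchy–Schwarz and the vanishing empirical
  -- error. Replacing `T n` by `τ h` costs at most `G * ‖T n - τ h‖`, because strong convergence is
  -- paired with a bounded sequence.
  have horth : ∀ h ∈ s, inner ℝ (J g₀) (J h) = 0 := by
    intro h hh
    let T : ℕ → H₂ := fun n => ((k (q n) : ℕ) : ℝ)⁻¹ •
      ∑ i ∈ Finset.range (k (q n)), RKHS.kerFun H₂ (x i) (h (x i))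
    have hT : Tendsto T atTop (𝓝 (τ h)) := (hlln h hh).comp (hk.comp hq)
    have hz : Tendsto (fun n => inner ℝ (A (u (q n)) - A fρ) (T n)) atTop (𝓝 0) := by
      have h1 : Tendsto (fun n => inner ℝ (A (u (q n)) - A fρ) (T n) ^ 2) atTop (𝓝 0) := by
        have h2 := (hemp.comp hq).const_mul ((κ * ‖h‖) ^ 2)
        rw [mul_zero] at h2
        exact squeeze_zero (fun n => sq_nonneg _)
          (fun n => inner_empirical_kerFun_sq_le hκ0 hκ _ h x (k (q n))) h2
      have h3 := h1.sqrt
      rw [Real.sqrt_zero] at h3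
      refine tendsto_zero_iff_abs_tendsto_zero _ |>.2 (h3.congr fun n => Real.sqrt_sq_eq_abs _)
    have hw : Tendsto (fun n => inner ℝ (A (u (q n)) - A fρ) (T n - τ h)) atTop (𝓝 0) := by
      have h1 : Tendsto (fun n => G * ‖T n - τ h‖) atTop (𝓝 0) := by
        simpa using (tendsto_iff_norm_sub_tendsto_zero.1 hT).const_mul G
      refine squeeze_zero_norm (fun n => ?_) h1
      exact (norm_inner_le_norm _ _).trans (by gcongr; exact hgb _)
    have hlim := hg.tendsto_inner (τ h)
    rw [real_inner_comm, hτ] at hlim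
    refine tendsto_nhds_unique hlim ?_
    have := hz.sub hw
    rw [sub_zero] at this
    refine this.congr fun n => ?_
    rw [← inner_sub_right, sub_sub_cancel, real_inner_comm]
  -- Orthogonality extends from the dense set to all `h`; then take `h = g₀`.
  have hJ0 : J g₀ = 0 := by
    have hall : ∀ h, inner ℝ (J g₀) (J h) = 0 := by
      have := Continuous.ext_on hs (f := fun h => inner ℝ (J g₀) (J h)) (g := fun _ => (0 : ℝ))
        (by fun_prop) continuous_const horth
      exact fun h => congrFun this h
    exact inner_self_eq_zero.1 (hall g₀)
  have hweak : WeaklyTendsto (fun n => J (A (u (q n)))) (J (A fρ)) := by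
    refine weaklyTendsto_of_forall_inner fun v => ?_
    have h1 := ((hg.map_clm J).tendsto_inner v).add_const (inner ℝ v (J (A fρ)))
    rw [hJ0, inner_zero_right, zero_add] at h1
    refine h1.congr fun n => ?_
    rw [← inner_add_right, map_sub, sub_add_cancel]
  obtain ⟨hu₀D, hA⟩ := hop.weakly_seq_closed _ u₀ _ (J (A fρ)) (fun n => huD (q n))
    (fun n => hJ _) hu hweak
  have heq : u₀ = fρ := hop.injective u₀ hu₀D fρ hfρ (hA.trans (hJ _))
  subst heq
  exact ⟨fun n => φ (ψ n), hu.tendsto_norm_sub (Eventually.of_forall fun n => hr (q n))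
    (hrlim.comp hq)⟩

end Deterministic

/-! ### Assembly on one event of full measure. -/

theorem mainTheorem2 {X Y H₁ H₂ Ω : Type*}
    [TopologicalSpace X] [PolishSpace X] [MeasurableSpace X] [BorelSpace X]
    [NormedAddCommGroup Y] [InnerProductSpace ℝ Y] [CompleteSpace Y]
    [TopologicalSpace.SeparableSpace Y] [MeasurableSpace Y] [BorelSpace Y]
    [NormedAddCommGroup H₁] [InnerProductSpace ℝ H₁] [CompleteSpace H₁]
    [TopologicalSpace.SeparableSpace H₁]
    [NormedAddCommGroup H₂] [InnerProductSpace ℝ H₂] [CompleteSpace H₂]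
    [TopologicalSpace.SeparableSpace H₂] [RKHS ℝ H₂ X Y]
    (ρ : Measure (X × Y)) [IsProbabilityMeasure ρ]
    (D : Set H₁) (A : H₁ → H₂) (fρ fbar : H₁)
    (hsol : IsTrueSolution ρ D A fρ)
    (hnoise : BernsteinNoise ρ (A fρ))
    (hker : KernelAssumption X Y H₂)
    (hop : OperatorAssumption ρ.fst D A)
    (lam : ℕ → ℝ) (hlam_pos : ∀ m, 1 ≤ m → 0 < lam m)
    (hlam : Tendsto lam atTop (𝓝 0))
    (hlam' : Tendsto (fun m : ℕ => Real.log m / (lam m * √(m : ℝ))) atTop (𝓝 0))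
    [MeasurableSpace Ω] (P : Measure Ω) [IsProbabilityMeasure P]
    (z : ℕ → Ω → X × Y) (hz_meas : ∀ i, Measurable (z i)) (hz_indep : iIndepFun z P)
    (hz_law : ∀ i, P.map (z i) = ρ) :
    ∀ᵐ ω ∂P, ∀ fhat : ℕ → H₁,
      (∀ m, 1 ≤ m →
        IsTikhonovMinimizer D A fbar (lam m) (fun i : Fin m => z i ω) (fhat m)) →
      Tendsto (fun m => ‖fhat m - fρ‖) atTop (𝓝 0) := by
  borelize H₂
  have hfρ : fρ ∈ D := interior_subset hsol.mem_interior
  obtain ⟨L, hL⟩ := hop.lipschitz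
  obtain ⟨J, hJ⟩ := hker.exists_embedding ρ.fst
  -- The null set of the strong law depends on `h`; a countable dense family keeps the union null.
  have hlln : ∀ᵐ ω ∂P, ∀ j : ℕ, Tendsto (fun m : ℕ => (m : ℝ)⁻¹ •
      ∑ i ∈ Finset.range m, RKHS.kerFun H₂ (z i ω).1
        (TopologicalSpace.denseSeq H₂ j (z i ω).1)) atTop
      (𝓝 (∫ p, RKHS.kerFun H₂ p.1 (TopologicalSpace.denseSeq H₂ j p.1) ∂ρ)) :=
    ae_all_iff.2 fun j => ae_tendsto_empirical_kerFun hker _ hz_meas hz_indep hz_law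
  filter_upwards [hlln, ae_eventually_norm_noise_sum_le hker (hker.measurable_coe (A fρ)) hnoise
    hsol.condExp_eq hz_meas hz_indep hz_law] with ω hω hN fhat hfhat
  set N : ℕ → H₂ := fun m => (m : ℝ)⁻¹ • ∑ i ∈ Finset.range m,
    RKHS.kerFun H₂ (z i ω).1 ((z i ω).2 - A fρ (z i ω).1) with hNdef
  -- The smallest `η` admitted by `IsTikhonovMinimizer.norm_sub_le`.
  set η : ℕ → ℝ := fun m => 2 * L * ‖N m‖ / lam m with hη
  have hηlim : Tendsto η atTop (𝓝 0) := by
    have h1 := hlam'.const_mul (24 * (L : ℝ))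
    rw [mul_zero] at h1
    refine squeeze_zero' ?_ ?_ h1
    · filter_upwards [eventually_ge_atTop 1] with m hm
      have := hlam_pos m hm
      positivity
    · filter_upwards [eventually_ge_atTop 1, hN] with m hm hNm
      have hl := hlam_pos m hm
      have hm0 : (0 : ℝ) < m := by exact_mod_cast hm
      have hNle : ‖N m‖ ≤ (m : ℝ)⁻¹ * (12 * (√(m : ℝ) * Real.log m)) := by
        rw [hNdef, norm_smul, norm_inv, Real.norm_natCast]
        gcongr
      have hsq : (m : ℝ)⁻¹ * √(m : ℝ) = 1 / √(m : ℝ) := by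
        rw [inv_mul_eq_div, Real.sqrt_div_self']
      calc η m ≤ 2 * L * ((m : ℝ)⁻¹ * (12 * (√(m : ℝ) * Real.log m))) / lam m := by
            simp only [hη]; gcongr
        _ = 24 * L * (((m : ℝ)⁻¹ * √(m : ℝ)) * Real.log m / lam m) := by ring
        _ = _ := by rw [hsq]; field_simp
  have hkey : ∀ m, 1 ≤ m → ‖fhat m - fbar‖ ≤ ‖fρ - fbar‖ + η m ∧
      (m : ℝ)⁻¹ * ∑ i ∈ Finset.range m, ‖(A (fhat m) - A fρ) (z i ω).1‖ ^ 2 ≤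
        lam m * (η m * (2 * ‖fρ - fbar‖ + η m) + ‖fρ - fbar‖ ^ 2) := fun m hm =>
    (hfhat m hm).norm_sub_le hL (hlam_pos m hm) (z := fun i => z i ω) hfρ
      (div_mul_cancel₀ _ (hlam_pos m hm).ne').ge
  have hηlim' := hηlim.comp (tendsto_add_atTop_nat 1)
  have hlam1 := hlam.comp (tendsto_add_atTop_nat 1)
  -- The shift discards `m = 0`, where neither positivity of `lam` nor minimality is assumed.
  rw [← tendsto_add_atTop_iff_nat 1]
  refine tendsto_of_empirical_tendsto hker hop hfρ hJ (x := fun i => (z i ω).1)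
    (τ := fun h => ∫ p, RKHS.kerFun H₂ p.1 (h p.1) ∂ρ) (hker.inner_integral_kerFun hJ)
    (TopologicalSpace.denseRange_denseSeq H₂) ?_ (u := fun n => fhat (n + 1))
    (fbar := fbar) (r := fun n => (‖fρ - fbar‖ + η (n + 1)) ^ 2) (k := fun n => n + 1)
    (fun n => (hfhat (n + 1) (Nat.le_add_left 1 n)).1) (fun n => ?_) ?_ (tendsto_add_atTop_nat 1) ?_
  · rintro _ ⟨j, rfl⟩
    exact hω j
  · gcongr
    exact (hkey (n + 1) (Nat.le_add_left 1 n)).1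
  · simpa using (hηlim'.const_add ‖fρ - fbar‖).pow 2
  · refine squeeze_zero (fun n => by positivity)
      (fun n => (hkey (n + 1) (Nat.le_add_left 1 n)).2) ?_
    have := hlam1.mul ((hηlim'.mul (hηlim'.const_add (2 * ‖fρ - fbar‖))).add_const
      (‖fρ - fbar‖ ^ 2))
    simpa using this
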